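/- Let $H$ be a separable infinite-dimensional complex Hilbert space, $K(H)^+$ the set of positive compact operators on $H$ and $F(H)^+$ the set of positive finite-rank operators. For $a\in K(H)^+$ let $\lambda_1(a)\ge\lambda_2(a)\ge\cdots$ be the list of the eigenvalues of $a$ in decreasing order, counted with multiplicity: if $a$ has infinite rank, only the nonzero eigenvalues are listed, and if $a$ has finite rank, the list of nonzero eigenvalues is continued by zeros. Write $\vee=\max$ (or $\sup$) and $\wedge=\min$. Let $\sigma(a)$ be the spectrum of $a$, let $C(\sigma(a))^+$ be the set of continuous functions $\sigma(a)\to[0,\infty)$, let $f(a)$ denote the continuous functional calculus, and for $k\ge 0$ let $kI\wedge a$ be $h(a)$ with $h(x)=\min(k,x)$. Functions $f,g$ on $\sigma(a)$ are comonotonic if $(f(s)-f(t))(g(s)-g(t))\ge 0$ for all $s,t\in\sigma(a)$. Let $\psi:K(H)^+\to[0,\infty)$ be an arbitrary (non-linear) map. Then the following are equivalent: 1. There is a monotone increasing function $\alpha:\{0,1,2,\dots\}\to[0,\infty)$ with $\alpha(0)=0$ such that $\psi(a)=\bigvee_{i=1}^{\infty}\bigl(\lambda_i(a)\wedge\alpha(i)\bigr)$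 for all $a\in K(H)^+$. 2. $\psi$ has the following six properties: (a) $\psi((f\vee g)(a))=\psi(f(a))\vee\psi(g(a))$ for all $a\in K(H)^+$ and all monotone increasing $f,g\in C(\sigma(a))^+$ with $f(0)=g(0)=0$; (b) $\psi(uau^*)=\psi(a)$ for all $a\in K(H)^+$ and all unitary $u\in B(H)$; (c) $a\le b$ implies $\psi(a)\le\psi(b)$ for all $a,b\in K(H)^+$; (d) $\psi(kI\wedge a)=k\wedge\psi(a)$ for all $a\in K(H)^+$ and all $k\ge 0$; (e) $\psi$ is lower semicontinuous on $K(H)^+$ in the operator norm; (f) for every $a\in F(H)^+$ the limit $\lim_{c\to\infty}\psi(ca)$ exists and is finite. 3. $\psi$ has properties (b)–(f) and (a') $\psi((f\vee g)(a))=\psi(f(a))\vee\psi(g(a))$ for all $a\in K(H)^+$ and all comonotonic $f,g\in C(\sigma(a))^+$ with $f(0)=g(0)=0$. -/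

import Mathlib

open scoped NNReal ENNReal Topology

namespace SugenoTrace

section

variable {H : Type*} [NormedAddCommGroup H] [InnerProductSpace ℂ H] [CompleteSpace H]

/-- Continuous functional calculus of a positive compact operator by a function vanishing at `0`
is compact. -/
theorem isCompactOperator_cfc {a : H →L[ℂ] H} (ha : IsCompactOperator a) (ha0 : 0 ≤ a)
    {f : ℝ≥0 → ℝ≥0} (hf0 : f 0 = 0) : IsCompactOperator (cfc f a : H →L[ℂ] H) := by
  by_cases hf : ContinuousOn f (spectrum ℝ≥0 a)
  swap
  · rw [cfc_apply_of_not_continuousOn a hf]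
    exact isCompactOperator_zero
  have hq : ContinuousOn f (quasispectrum ℝ≥0 a) := by
    rw [quasispectrum_eq_spectrum_union_zero]
    exact hf.union_of_isClosed (continuousOn_singleton f 0)
      (isCompact_iff_compactSpace.mpr inferInstance).isClosed isClosed_singleton
  rw [← cfcₙ_eq_cfc hq hf0, cfcₙ_nnreal_eq_real f a ha0]
  have hcl : IsClosed {T : H →L[ℂ] H | IsCompactOperator T} :=
    isClosed_setOfPred_isCompactOperator
  let S : NonUnitalStarSubalgebra ℝ (H →L[ℂ] H) :=
    { carrier := {T | IsCompactOperator T ∧ IsCompactOperator (star T : H →L[ℂ] H)}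
      add_mem' := fun {x y} hx hy =>
        ⟨hx.1.add hy.1, by rw [star_add]; exact hx.2.add hy.2⟩
      zero_mem' := ⟨isCompactOperator_zero, by rw [star_zero]; exact isCompactOperator_zero⟩
      mul_mem' := fun {x y} hx hy =>
        ⟨hx.1.comp_clm y, by rw [star_mul]; exact hy.2.comp_clm (star x)⟩
      smul_mem' := fun c x hx =>
        ⟨hx.1.smul c, by rw [star_smul]; exact hx.2.smul (star c)⟩
      star_mem' := fun {x} hx => ⟨hx.2, by rw [star_star]; exact hx.1⟩ }
  have hS : IsClosed (S : Set (H →L[ℂ] H)) :=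
    hcl.inter (hcl.preimage continuous_star)
  have haS : a ∈ S := ⟨ha, by rw [(IsSelfAdjoint.of_nonneg ha0).star_eq]; exact ha⟩
  exact (cfcₙ_mem (𝕜 := ℝ) (𝕜' := ℝ) (s := S) _ haS).1

end

/-- The set `K(H)⁺` of positive compact operators on `H`, with the topology of the operator norm
and the usual order of operators. -/
abbrev KPos (H : Type*) [NormedAddCommGroup H] [InnerProductSpace ℂ H] [CompleteSpace H] : Type _ :=
  {a : H →L[ℂ] H // IsCompactOperator a ∧ 0 ≤ a}

noncomputable section

variable {H : Type*} [NormedAddCommGroup H] [InnerProductSpace ℂ H] [CompleteSpace H]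

namespace KPos

/-- The functional calculus `f(a)` for `a ∈ K(H)⁺` and `f ≥ 0` with `f(0) = 0`; only the values
of `f` on the spectrum of `a` matter. -/
def funcCalc (a : KPos H) (f : ℝ≥0 → ℝ≥0) (hf0 : f 0 = 0) : KPos H :=
  ⟨cfc f a.1, isCompactOperator_cfc a.2.1 a.2.2 hf0, cfc_predicate f a.1⟩

/-- The operator `k I ∧ a`, that is, `g(a)` with `g(x) = min k x`. -/
def truncate (k : ℝ≥0) (a : KPos H) : KPos H :=
  a.funcCalc (fun x => min k x) (by simp)

/-- The operator `c a` for a scalar `c ≥ 0`. -/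
def scale (c : ℝ≥0) (a : KPos H) : KPos H :=
  ⟨(c : ℝ) • a.1, a.2.1.smul (c : ℝ), smul_nonneg c.2 a.2.2⟩

/-- The operator `u a u*` for a unitary `u`. -/
def conj (u : unitary (H →L[ℂ] H)) (a : KPos H) : KPos H :=
  ⟨(u : H →L[ℂ] H) * a.1 * star (u : H →L[ℂ] H),
    (a.2.1.clm_comp (u : H →L[ℂ] H)).comp_clm (star (u : H →L[ℂ] H)),
    star_right_conjugate_nonneg a.2.2 (u : H →L[ℂ] H)⟩

/-- The `(n+1)`-st entry `λ_{n+1}(a)` of the eigenvalue sequence of `a ∈ K(H)⁺`, that is, of the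
decreasing list of its eigenvalues counted with multiplicity (continued by zeros if `a` has finite
rank): the largest `t ≥ 0` such that at least `n+1` eigenvalues, counted with multiplicity,
are `≥ t`. The number of eigenvalues `≥ t` counted with multiplicity is the dimension of the sum of
the eigenspaces of the eigenvalues `s ≥ t`. -/
def eigenvalueSeq (a : KPos H) (n : ℕ) : ℝ≥0 :=
  sSup {t : ℝ≥0 | ((n + 1 : ℕ) : Cardinal) ≤
    Module.rank ℂ ↥(⨆ s ∈ Set.Ici t,
      Module.End.eigenspace (a.1 : H →ₗ[ℂ] H) (((s : ℝ≥0) : ℝ) : ℂ))}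

end KPos

/-- The non-linear trace of Sugeno type `ψ_α(a) = ⋁_{i ≥ 1} (λ_i(a) ∧ α(i))`. -/
def sugenoTrace (α : ℕ → ℝ≥0) (a : KPos H) : ℝ≥0∞ :=
  ⨆ n : ℕ, ((min (a.eigenvalueSeq n) (α (n + 1)) : ℝ≥0) : ℝ≥0∞)

/-- Two functions are comonotonic on `s`. -/
def ComonotonicOn (f g : ℝ≥0 → ℝ≥0) (s : Set ℝ≥0) : Prop :=
  ∀ x ∈ s, ∀ y ∈ s, 0 ≤ ((f x : ℝ) - f y) * ((g x : ℝ) - g y)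

variable (ψ : KPos H → ℝ≥0)

/-- `ψ` is unitarily invariant. -/
def UnitarilyInvariant : Prop :=
  ∀ (a : KPos H) (u : unitary (H →L[ℂ] H)), ψ (KPos.conj u a) = ψ a

/-- `ψ(k I ∧ a) = k ∧ ψ(a)`. -/
def PositivelyFHomogeneous : Prop :=
  ∀ (a : KPos H) (k : ℝ≥0), ψ (KPos.truncate k a) = min k (ψ a)

/-- `ψ((f ∨ g)(a)) = ψ(f(a)) ∨ ψ(g(a))` for comonotonic `f, g ∈ C(σ(a))⁺` vanishing at `0`. -/
def ComonotonicFAdditive : Prop :=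
  ∀ (a : KPos H) (f g : ℝ≥0 → ℝ≥0) (hf0 : f 0 = 0) (hg0 : g 0 = 0),
    ContinuousOn f (spectrum ℝ≥0 a.1) → ContinuousOn g (spectrum ℝ≥0 a.1) →
    ComonotonicOn f g (spectrum ℝ≥0 a.1) →
    ψ (a.funcCalc (fun x => max (f x) (g x)) (by simp [hf0, hg0])) =
      max (ψ (a.funcCalc f hf0)) (ψ (a.funcCalc g hg0))

/-- `ψ((f ∨ g)(a)) = ψ(f(a)) ∨ ψ(g(a))` for monotone increasing `f, g ∈ C(σ(a))⁺` vanishing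
at `0`. -/
def MonotonicIncreasingFAdditive : Prop :=
  ∀ (a : KPos H) (f g : ℝ≥0 → ℝ≥0) (hf0 : f 0 = 0) (hg0 : g 0 = 0),
    ContinuousOn f (spectrum ℝ≥0 a.1) → ContinuousOn g (spectrum ℝ≥0 a.1) →
    MonotoneOn f (spectrum ℝ≥0 a.1) → MonotoneOn g (spectrum ℝ≥0 a.1) →
    ψ (a.funcCalc (fun x => max (f x) (g x)) (by simp [hf0, hg0])) =
      max (ψ (a.funcCalc f hf0)) (ψ (a.funcCalc g hg0))

/-- For every positive finite rank operator `a`, the limit of `ψ(c a)` as `c → ∞` is finite. -/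
def FiniteLimitOnFiniteRank : Prop :=
  ∀ a : KPos H, FiniteDimensional ℂ (LinearMap.range (a.1 : H →ₗ[ℂ] H)) →
    ∃ L : ℝ≥0, Filter.Tendsto (fun c : ℝ≥0 => ψ (KPos.scale c a)) Filter.atTop (𝓝 L)

end

end SugenoTrace

/-!
By the spectral theorem a positive compact operator `a` is diagonal in some Hilbert basis, with
entries `μ i`, and `λ_n(a)` is determined by the counting function `r ↦ #{i | r < μ i}`: one has
`r < λ_n(a)` exactly when at least `n` entries exceed `r`. Functional calculus, truncation and
comonotonic maxima act transparently on this function, while the min-max principle gives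
monotonicity of `λ_n` and its Lipschitz continuity in the operator norm. This shows that Sugeno
traces have all the listed properties.

Conversely, `ψ` determines `α(n)` as the limit of `ψ(c p)`, `c → ∞`, for a projection `p` of
rank `n`. Fix `r > 0` and let `p` be the finite-rank spectral projection of `a` for the eigenvalues
exceeding `r`. The lower bound on `ψ(a)` comes from `r p ≤ a`. For the upper bound, dominate `a` by
`(f ∨ g)(a)` with `f(x) = r ∧ x` and `g` a steep increasing function vanishing up to `r`: then
`g(a)` is at most a multiple of `p`.
-/

namespace SugenoTrace

universe u v

section HilbertBasis

variable {𝕜 E ι : Type*} [RCLike 𝕜] [NormedAddCommGroup E] [InnerProductSpace 𝕜 E]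

theorem continuousLinearMap_ext_hilbertBasis {F : Type*} [AddCommMonoid F] [Module 𝕜 F]
    [TopologicalSpace F] [T2Space F] (b : HilbertBasis ι 𝕜 E) {S T : E →L[𝕜] F}
    (h : ∀ i, S (b i) = T (b i)) : S = T :=
  ContinuousLinearMap.ext_on (Submodule.dense_iff_topologicalClosure_eq_top.2 b.dense_span)
    (Set.forall_mem_range.2 h)

theorem hasSum_norm_inner_sq (b : HilbertBasis ι 𝕜 E) (x : E) :
    HasSum (fun i => ‖inner 𝕜 (b i) x‖ ^ 2) (‖x‖ ^ 2) := by
  have h := (b.hasSum_inner_mul_inner x x).mapL RCLike.reCLM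
  simp only [RCLike.reCLM_apply, inner_self_eq_norm_sq] at h
  refine h.congr_fun fun i => ?_
  rw [inner_mul_symm_re_eq_norm, norm_mul, norm_inner_symm, sq]

theorem mem_span_image_hilbertBasis_iff (b : HilbertBasis ι 𝕜 E) {S : Finset ι} {x : E} :
    x ∈ Submodule.span 𝕜 (b '' S) ↔ ∀ i ∉ S, inner 𝕜 (b i) x = 0 := by
  constructor
  · intro hx i hi
    have hS : Submodule.span 𝕜 (b '' S) ≤ LinearMap.ker (innerₛₗ 𝕜 (b i)) := by
      rw [Submodule.span_le]
      rintro _ ⟨j, hj, rfl⟩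
      exact b.orthonormal.2 (ne_of_mem_of_not_mem hj hi).symm
    exact hS hx
  · intro h
    have hsum : HasSum (fun i => b.repr x i • b i) (∑ i ∈ S, b.repr x i • b i) :=
      hasSum_sum_of_ne_finset_zero fun i hi => by rw [b.repr_apply_apply, h i hi, zero_smul]
    rw [(b.hasSum_repr x).unique hsum]
    exact Submodule.sum_mem _ fun i hi =>
      Submodule.smul_mem _ _ (Submodule.subset_span ⟨i, hi, rfl⟩)

instance finiteDimensional_span_image (v : ι → E) (S : Finset ι) :
    FiniteDimensional 𝕜 (Submodule.span 𝕜 (v '' S)) :=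
  FiniteDimensional.span_of_finite 𝕜 (S.finite_toSet.image v)

theorem finrank_span_image_of_orthonormal {v : ι → E} (hv : Orthonormal 𝕜 v) (S : Finset ι) :
    Module.finrank 𝕜 (Submodule.span 𝕜 (v '' S)) = S.card := by
  have hli : LinearIndependent 𝕜 fun i : S => v i :=
    hv.linearIndependent.comp _ Subtype.val_injective
  have h := finrank_span_eq_card hli
  rw [Fintype.card_coe] at h
  rw [← h, Set.image_eq_range]
  rfl

theorem exists_mem_ne_zero_forall_inner_eq_zero (v : ι → E) {S : Finset ι} {V : Submodule 𝕜 E}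
    (h : S.card < Module.finrank 𝕜 V) : ∃ x ∈ V, x ≠ 0 ∧ ∀ i ∈ S, inner 𝕜 (v i) x = 0 := by
  have : FiniteDimensional 𝕜 V := Module.finite_of_finrank_pos (by lia)
  let coeffs : V →ₗ[𝕜] (S → 𝕜) := LinearMap.pi fun i => (innerSL 𝕜 (v i)).toLinearMap ∘ₗ V.subtype
  have hker : LinearMap.ker coeffs ≠ ⊥ := LinearMap.ker_ne_bot_of_finrank_lt (by simpa using h)
  obtain ⟨x, hx, hx0⟩ := (Submodule.ne_bot_iff _).1 hker
  exact ⟨x, x.2, by simpa using hx0, fun i hi => congrFun (LinearMap.mem_ker.1 hx) ⟨i, hi⟩⟩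

theorem exists_hilbertBasis_of_orthogonalFamily {E : Type u} [NormedAddCommGroup E]
    [InnerProductSpace 𝕜 E] [CompleteSpace E] {κ : Type v} {V : κ → Submodule 𝕜 E}
    [∀ k, CompleteSpace (V k)] (hV : OrthogonalFamily 𝕜 (fun k => V k) fun k => (V k).subtypeₗᵢ)
    (htop : (⨆ k, V k)ᗮ = ⊥) :
    ∃ (ι : Type (max u v)) (b : HilbertBasis ι 𝕜 E), ∀ i, ∃ k, b i ∈ V k := by
  choose w v _ using fun k => exists_hilbertBasis 𝕜 (V k)
  have hon := hV.orthonormal_sigma_orthonormal fun k => (v k).orthonormal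
  have hbot : (Submodule.span 𝕜 (Set.range fun p : Σ k, w k =>
      (V p.1).subtypeₗᵢ (v p.1 p.2)))ᗮ = ⊥ := by
    rw [eq_bot_iff, ← htop, ← Submodule.iInf_orthogonal, le_iInf_iff]
    intro k x hx
    have hzero : innerSL 𝕜 x ∘L (V k).subtypeL = 0 :=
      continuousLinearMap_ext_hilbertBasis (v k) fun i =>
        (Submodule.mem_orthogonal' _ _).1 hx _ (Submodule.subset_span ⟨⟨k, i⟩, rfl⟩)
    exact (Submodule.mem_orthogonal' _ _).2 fun y hy => DFunLike.congr_fun hzero ⟨y, hy⟩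
  refine ⟨Σ k, w k, HilbertBasis.mkOfOrthogonalEqBot hon hbot, fun p => ⟨p.1, ?_⟩⟩
  rw [HilbertBasis.coe_mkOfOrthogonalEqBot]
  exact (v p.1 p.2).2

end HilbertBasis

section Encard

variable {ι : Type*} {s : Set ι} {n : ℕ}

theorem natCast_le_encard_iff : (n : ℕ∞) ≤ s.encard ↔ ∃ S : Finset ι, ↑S ⊆ s ∧ S.card = n := by
  constructor
  · intro h
    obtain ⟨t, hts, ht⟩ := Set.exists_subset_encard_eq h
    lift t to Finset ι using Set.finite_of_encard_eq_coe ht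
    exact ⟨t, hts, by simpa using ht⟩
  · rintro ⟨S, hS, rfl⟩
    simpa using Set.encard_le_encard hS

theorem natCast_lt_encard_iff :
    (n : ℕ∞) < s.encard ↔ ∃ S : Finset ι, ↑S ⊆ s ∧ S.card = n + 1 := by
  rw [← natCast_le_encard_iff, Nat.cast_succ, ENat.add_one_le_iff (ENat.natCast_ne_top n)]

end Encard

section Order

variable {ι β : Type*}

theorem exists_lt_forall_le_of_forall_lt [LinearOrder β] [NoMaxOrder β] {μ : ι → β} {S : Finset ι}
    {r : β} (h : ∀ i ∈ S, r < μ i) : ∃ t > r, ∀ i ∈ S, t ≤ μ i := by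
  rcases S.eq_empty_or_nonempty with rfl | hS
  · simpa using exists_gt r
  · exact ⟨S.inf' hS μ, (Finset.lt_inf'_iff hS).2 h, fun _ hi => Finset.inf'_le μ hi⟩

theorem comonotonicOn_iff_monovaryOn {f g : ℝ≥0 → ℝ≥0} {s : Set ℝ≥0} :
    ComonotonicOn f g s ↔ MonovaryOn f g s := by
  have hcoe : MonovaryOn f g s ↔ MonovaryOn (fun x => (f x : ℝ)) (fun x => (g x : ℝ)) s := by
    simp only [MonovaryOn, NNReal.coe_lt_coe, NNReal.coe_le_coe]
  rw [hcoe, monovaryOn_iff_forall_mul_nonneg]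
  exact ⟨fun h x hx y hy => h y hy x hx, fun h x hx y hy => h hy hx⟩

theorem setOf_lt_subset_or_of_monovary [LinearOrder β] {f g : ι → β} (hfg : Monovary f g) (r : β) :
    {i | r < f i} ⊆ {i | r < g i} ∨ {i | r < g i} ⊆ {i | r < f i} := by
  by_contra! h
  obtain ⟨i, hfi, hgi⟩ := Set.not_subset.1 h.1
  obtain ⟨j, hgj, hfj⟩ := Set.not_subset.1 h.2
  exact hfj (lt_of_lt_of_le hfi (hfg ((not_lt.1 hgi).trans_lt hgj)))

theorem encard_setOf_lt_max_of_monovary [LinearOrder β] {f g : ι → β} (hfg : Monovary f g)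
    (r : β) :
    {i | r < max (f i) (g i)}.encard = max {i | r < f i}.encard {i | r < g i}.encard := by
  have hunion : {i | r < max (f i) (g i)} = {i | r < f i} ∪ {i | r < g i} :=
    Set.ext fun i => lt_max_iff
  rw [hunion]
  rcases setOf_lt_subset_or_of_monovary hfg r with hle | hle
  · rw [Set.union_eq_right.2 hle, max_eq_right (Set.encard_le_encard hle)]
  · rw [Set.union_eq_left.2 hle, max_eq_left (Set.encard_le_encard hle)]

end Order

section Diagonal

variable {H : Type u} [NormedAddCommGroup H] [InnerProductSpace ℂ H]

/-- The operator `a` is diagonal in the Hilbert basis `b`, with entries `μ ≥ 0`. By the spectral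
theorem every `a ∈ K(H)⁺` is of this form; unlike the eigenvalue sequence, the family `μ` is not
ordered, and all eigenvalues `0` are listed. -/
def IsDiagonal {ι : Type*} (b : HilbertBasis ι ℂ H) (a : H →L[ℂ] H) (μ : ι → ℝ≥0) : Prop :=
  ∀ i, a (b i) = ((μ i : ℝ) : ℂ) • b i

variable {ι : Type*} {b : HilbertBasis ι ℂ H} {a c : H →L[ℂ] H} {μ ν : ι → ℝ≥0}

namespace IsDiagonal

theorem unique (ha : IsDiagonal b a μ) (hc : IsDiagonal b c μ) : a = c :=
  continuousLinearMap_ext_hilbertBasis b fun i => by rw [ha i, hc i]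

theorem sub (hc : IsDiagonal b c ν) (ha : IsDiagonal b a μ) (h : μ ≤ ν) :
    IsDiagonal b (c - a) (ν - μ) := by
  intro i
  rw [sub_apply, hc i, ha i, ← sub_smul, Pi.sub_apply, NNReal.coe_sub (h i), Complex.ofReal_sub]

theorem smul (ha : IsDiagonal b a μ) (k : ℝ≥0) :
    IsDiagonal b ((k : ℝ) • a) fun i => k * μ i := by
  intro i
  rw [smul_apply, ha i, ← Complex.coe_smul, smul_smul, NNReal.coe_mul, Complex.ofReal_mul]

theorem inner_apply (ha : IsDiagonal b a μ) (x : H) (i : ι) :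
    inner ℂ (b i) (a x) = ((μ i : ℝ) : ℂ) * inner ℂ (b i) x := by
  have h : innerSL ℂ (b i) ∘L a = ((μ i : ℝ) : ℂ) • innerSL ℂ (b i) := by
    refine continuousLinearMap_ext_hilbertBasis b fun j => ?_
    rcases eq_or_ne i j with rfl | hij
    · simp [ha i]
    · simp [ha j, b.orthonormal.2 hij]
  exact DFunLike.congr_fun h x

theorem hasSum_re_inner (ha : IsDiagonal b a μ) (x : H) :
    HasSum (fun i => (μ i : ℝ) * ‖inner ℂ (b i) x‖ ^ 2) (inner ℂ x (a x)).re := by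
  refine ((b.hasSum_inner_mul_inner x (a x)).mapL Complex.reCLM).congr_fun fun i => ?_
  rw [Complex.reCLM_apply, ha.inner_apply, mul_left_comm, Complex.re_ofReal_mul,
    ← inner_conj_symm x (b i), Complex.conj_mul', ← Complex.ofReal_pow, Complex.ofReal_re]

theorem mul_norm_sq_le_re_inner (ha : IsDiagonal b a μ) {t : ℝ≥0} {x : H}
    (h : ∀ i, μ i < t → inner ℂ (b i) x = 0) : t * ‖x‖ ^ 2 ≤ (inner ℂ x (a x)).re := by
  refine hasSum_le (fun i => ?_) ((hasSum_norm_inner_sq b x).mul_left (t : ℝ))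
    (ha.hasSum_re_inner x)
  rcases lt_or_ge (μ i) t with hi | hi
  · simp [h i hi]
  · gcongr

theorem re_inner_le_mul_norm_sq (ha : IsDiagonal b a μ) {r : ℝ≥0} {x : H}
    (h : ∀ i, r < μ i → inner ℂ (b i) x = 0) : (inner ℂ x (a x)).re ≤ r * ‖x‖ ^ 2 := by
  refine hasSum_le (fun i => ?_) (ha.hasSum_re_inner x)
    ((hasSum_norm_inner_sq b x).mul_left (r : ℝ))
  rcases lt_or_ge r (μ i) with hi | hi
  · simp [h i hi]
  · gcongr

theorem le_norm (ha : IsDiagonal b a μ) (i : ι) : μ i ≤ ‖a‖₊ := by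
  have h := a.le_opNNNorm (b i)
  rw [ha i, nnnorm_smul] at h
  have hb : ‖b i‖₊ = 1 := NNReal.eq (b.orthonormal.1 i)
  simpa [hb] using h

theorem mem_spectrum_real (ha : IsDiagonal b a μ) (i : ι) : (μ i : ℝ) ∈ spectrum ℝ a := by
  rw [spectrum.mem_iff]
  intro hunit
  have hker : (algebraMap ℝ (H →L[ℂ] H) (μ i) - a) (b i) = 0 := by
    simp [Algebra.algebraMap_eq_smul_one, ha i]
  obtain ⟨v, hv⟩ := hunit
  refine b.orthonormal.ne_zero i ?_
  calc b i = (↑v⁻¹ * ↑v : H →L[ℂ] H) (b i) := by simp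
    _ = 0 := by rw [hv, mul_apply_eq_comp, hker, map_zero]

theorem mem_spectrum (ha : IsDiagonal b a μ) (i : ι) : μ i ∈ spectrum ℝ≥0 a :=
  (spectrum.algebraMap_mem_iff ℝ).1 (ha.mem_spectrum_real i)

theorem finite_setOf_lt (ha : IsDiagonal b a μ) (hcpt : IsCompactOperator a) {r : ℝ≥0}
    (hr : 0 < r) : {i | r < μ i}.Finite := by
  have hsep : ∀ i j, i ≠ j → (μ i : ℝ) ≤ dist (a (b i)) (a (b j)) := by
    intro i j hij
    have hcoef : inner ℂ (b i) (a (b i) - a (b j)) = ((μ i : ℝ) : ℂ) := by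
      simp [ha.inner_apply, b.orthonormal.2 hij, b.orthonormal.1 i]
    have h := norm_inner_le_norm (𝕜 := ℂ) (b i) (a (b i) - a (b j))
    rwa [hcoef, b.orthonormal.1 i, one_mul, Complex.norm_real, NNReal.norm_eq,
      ← dist_eq_norm] at h
  obtain ⟨t, ht, hcover⟩ := Metric.totallyBounded_iff.1
    (hcpt.isCompact_closure_image_closedBall 1).totallyBounded (r / 2) (by positivity)
  have hball : ∀ i, ∃ y ∈ t, dist (a (b i)) y < r / 2 := by
    intro i
    simpa using hcover (subset_closure ⟨b i, by simp [b.orthonormal.1], rfl⟩)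
  choose y hyt hy using hball
  refine Set.Finite.of_injOn (f := y) (fun i _ => hyt i) (fun i hi j _ hij => ?_) ht
  by_contra hne
  have htri := dist_triangle_right (a (b i)) (a (b j)) (y i)
  have hr_lt : (r : ℝ) < μ i := NNReal.coe_lt_coe.2 hi
  have hyj := hij ▸ hy j
  linarith [hsep i j hne, hy i]

variable [CompleteSpace H]

theorem isSelfAdjoint (ha : IsDiagonal b a μ) : IsSelfAdjoint a := by
  refine IsDiagonal.unique (b := b) (μ := μ) (fun i => ext_inner_left ℂ fun x => ?_) ha
  rw [ContinuousLinearMap.star_eq_adjoint, ContinuousLinearMap.adjoint_inner_right,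
    ← inner_conj_symm, ha.inner_apply, map_mul, Complex.conj_ofReal, inner_conj_symm,
    inner_smul_right]

theorem nonneg (ha : IsDiagonal b a μ) : 0 ≤ a := by
  rw [ContinuousLinearMap.nonneg_iff_isPositive, ContinuousLinearMap.isPositive_def']
  refine ⟨ha.isSelfAdjoint, fun x => ?_⟩
  rw [ContinuousLinearMap.reApplyInnerSelf_apply, inner_re_symm]
  exact (ha.hasSum_re_inner x).nonneg fun i => by positivity

theorem mono (ha : IsDiagonal b a μ) (hc : IsDiagonal b c ν) (h : μ ≤ ν) : a ≤ c :=
  sub_nonneg.1 (hc.sub ha h).nonneg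

theorem exists_conj (ha : IsDiagonal b a μ) (u : unitary (H →L[ℂ] H)) :
    ∃ b' : HilbertBasis ι ℂ H, IsDiagonal b' ((u : H →L[ℂ] H) * a * star (u : H →L[ℂ] H)) μ := by
  classical
  let b' : HilbertBasis ι ℂ H := ⟨(Unitary.linearIsometryEquiv u).symm.trans b.repr⟩
  have hb' : ∀ i, b' i = (u : H →L[ℂ] H) (b i) := fun i => by
    rw [← b'.repr_symm_single, ← b.repr_symm_single]
    rfl
  have hstar : ∀ x, star (u : H →L[ℂ] H) ((u : H →L[ℂ] H) x) = x := fun x => by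
    rw [← mul_apply_eq_comp, Unitary.coe_star_mul_self]
    rfl
  refine ⟨b', fun i => ?_⟩
  rw [hb', mul_apply_eq_comp, mul_apply_eq_comp, hstar, ha i, map_smul]

end IsDiagonal

variable [CompleteSpace H]

theorem cfc_apply_of_apply_eq_smul (hsa : IsSelfAdjoint a) {f : ℝ → ℝ}
    (hf : ContinuousOn f (spectrum ℝ a)) {t : ℝ} (ht : t ∈ spectrum ℝ a) {x : H}
    (hx : a x = (t : ℂ) • x) : cfc f a x = (f t : ℂ) • x := by
  suffices key : ∀ g : C(spectrum ℝ a, ℝ), cfcHom hsa g x = (g ⟨t, ht⟩ : ℂ) • x by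
    rw [cfc_apply f a]
    exact key _
  intro g
  induction g using ContinuousMap.induction_on_of_compact with
  | const r =>
    have hconst : ContinuousMap.const (spectrum ℝ a) r = algebraMap ℝ _ r := rfl
    rw [hconst, AlgHomClass.commutes]
    simp [Algebra.algebraMap_eq_smul_one]
  | id => simpa [cfcHom_id] using hx
  | star_id => simpa [cfcHom_id, map_star, hsa.star_eq] using hx
  | add g h hg hh => simp [hg, hh, add_smul]
  | mul g h hg hh =>
    rw [map_mul, mul_apply_eq_comp, hh, map_smul, hg, smul_smul, mul_comm, ContinuousMap.mul_apply,
      Complex.ofReal_mul]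
  | frequently g hg =>
    refine hg.mem_of_closed
      (s := {g : C(spectrum ℝ a, ℝ) | cfcHom hsa g x = (g ⟨t, ht⟩ : ℂ) • x})
      (isClosed_eq ?_ (by fun_prop))
    exact (ContinuousLinearMap.apply ℂ H x).continuous.comp (cfcHom_continuous hsa)

theorem IsDiagonal.cfc (ha : IsDiagonal b a μ) {f : ℝ≥0 → ℝ≥0}
    (hf : ContinuousOn f (spectrum ℝ≥0 a)) : IsDiagonal b (cfc f a) (f ∘ μ) := by
  have hcont : ContinuousOn (fun x : ℝ => (f x.toNNReal : ℝ)) (spectrum ℝ a) := by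
    refine NNReal.continuous_coe.comp_continuousOn
      (hf.comp continuous_real_toNNReal.continuousOn fun x hx => ?_)
    rw [← spectrum.algebraMap_mem_iff ℝ, NNReal.algebraMap_eq_coe,
      Real.coe_toNNReal x (spectrum_nonneg_of_nonneg ha.nonneg hx)]
    exact hx
  intro i
  rw [cfc_nnreal_eq_real f a ha.nonneg,
    cfc_apply_of_apply_eq_smul ha.isSelfAdjoint hcont (ha.mem_spectrum_real i) (ha i),
    Real.toNNReal_coe, Function.comp_apply]

open scoped ComplexOrder in
theorem exists_isDiagonal (hcpt : IsCompactOperator a) (ha : 0 ≤ a) :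
    ∃ (ι : Type u) (b : HilbertBasis ι ℂ H) (μ : ι → ℝ≥0), IsDiagonal b a μ := by
  have hpos := (ContinuousLinearMap.nonneg_iff_isPositive a).1 ha
  obtain ⟨ι, b, hb⟩ := exists_hilbertBasis_of_orthogonalFamily
    hpos.isSymmetric.orthogonalFamily_eigenspaces
    (ContinuousLinearMap.orthogonalComplement_iSup_eigenspaces_eq_bot hcpt hpos.isSymmetric)
  choose s hs using hb
  refine ⟨ι, b, fun i => (s i).re.toNNReal, fun i => ?_⟩
  have heig : a (b i) = s i • b i := Module.End.mem_eigenspace_iff.1 (hs i)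
  have hnonneg : 0 ≤ s i := by
    simpa [heig, inner_smul_right, b.orthonormal.1 i] using hpos.inner_nonneg_right (b i)
  obtain ⟨hre, him⟩ := Complex.nonneg_iff.1 hnonneg
  rw [heig, Real.coe_toNNReal _ hre]
  congr 1
  exact Complex.ext rfl him.symm

end Diagonal

section EigenvalueSeq

variable {H : Type u} [NormedAddCommGroup H] [InnerProductSpace ℂ H]

/-- The sum of the eigenspaces of `a` for the eigenvalues `s ≥ t`: the subspace whose dimension is
counted in `KPos.eigenvalueSeq`. -/
def spectralSubspace (a : H →L[ℂ] H) (t : ℝ≥0) : Submodule ℂ H :=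
  ⨆ s ∈ Set.Ici t, Module.End.eigenspace (a : H →ₗ[ℂ] H) (((s : ℝ≥0) : ℝ) : ℂ)

theorem spectralSubspace_le_range (a : H →L[ℂ] H) {t : ℝ≥0} (ht : 0 < t) :
    spectralSubspace a t ≤ LinearMap.range (a : H →ₗ[ℂ] H) := by
  refine iSup₂_le fun s hs x hx => ⟨((s : ℝ) : ℂ)⁻¹ • x, ?_⟩
  have hs0 : ((s : ℝ) : ℂ) ≠ 0 := by exact_mod_cast (ht.trans_le hs).ne'
  rw [map_smul, Module.End.mem_eigenspace_iff.1 hx, inv_smul_smul₀ hs0]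

namespace IsDiagonal

variable {ι : Type*} {b : HilbertBasis ι ℂ H} {a : H →L[ℂ] H} {μ : ι → ℝ≥0}

theorem span_image_le_spectralSubspace (ha : IsDiagonal b a μ) {t : ℝ≥0} {S : Set ι}
    (hS : ∀ i ∈ S, t ≤ μ i) : Submodule.span ℂ (b '' S) ≤ spectralSubspace a t := by
  rw [Submodule.span_le]
  rintro _ ⟨i, hi, rfl⟩
  exact Submodule.mem_iSup_of_mem (μ i) <| Submodule.mem_iSup_of_mem (hS i hi) <|
    Module.End.mem_eigenspace_iff.2 (ha i)

theorem spectralSubspace_le_span_image (ha : IsDiagonal b a μ) {t : ℝ≥0} {S : Finset ι}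
    (hS : ∀ i, t ≤ μ i → i ∈ S) : spectralSubspace a t ≤ Submodule.span ℂ (b '' S) := by
  refine iSup₂_le fun s hs x hx => (mem_span_image_hilbertBasis_iff b).2 fun i hi => ?_
  have hne : ((s : ℝ) : ℂ) ≠ ((μ i : ℝ) : ℂ) := fun h => by
    have hsi : s = μ i := by exact_mod_cast h
    exact hi (hS i (hsi ▸ hs))
  have heig : a x = ((s : ℝ) : ℂ) • x := Module.End.mem_eigenspace_iff.1 hx
  have hcoef := ha.inner_apply x i
  rw [heig, inner_smul_right] at hcoef
  exact (mul_eq_mul_right_iff.1 hcoef).resolve_left hne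

theorem natCast_le_rank_spectralSubspace_iff (ha : IsDiagonal b a μ) {t : ℝ≥0} {n : ℕ} :
    (n : Cardinal) ≤ Module.rank ℂ (spectralSubspace a t) ↔
      (n : ℕ∞) ≤ {i | t ≤ μ i}.encard := by
  constructor
  · contrapose!
    intro h
    have hfin := Set.finite_of_encard_le_coe h.le
    rw [hfin.encard_eq_coe_toFinset_card, Nat.cast_lt] at h
    have hle : spectralSubspace a t ≤ Submodule.span ℂ (b '' hfin.toFinset) :=
      ha.spectralSubspace_le_span_image fun _ hi => hfin.mem_toFinset.2 hi
    refine (Submodule.rank_mono hle).trans_lt ?_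
    rwa [← Module.finrank_eq_rank, finrank_span_image_of_orthonormal b.orthonormal, Nat.cast_lt]
  · rw [natCast_le_encard_iff]
    rintro ⟨S, hS, rfl⟩
    rw [← finrank_span_image_of_orthonormal b.orthonormal S, Module.finrank_eq_rank]
    exact Submodule.rank_mono (ha.span_image_le_spectralSubspace hS)

theorem exists_submodule_mul_norm_sq_le (ha : IsDiagonal b a μ) {t : ℝ≥0} {S : Finset ι}
    (hS : ∀ i ∈ S, t ≤ μ i) : ∃ V : Submodule ℂ H, Module.finrank ℂ V = S.card ∧
      ∀ x ∈ V, t * ‖x‖ ^ 2 ≤ (inner ℂ x (a x)).re :=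
  ⟨Submodule.span ℂ (b '' S), finrank_span_image_of_orthonormal b.orthonormal S, fun _ hx =>
    ha.mul_norm_sq_le_re_inner fun i hi =>
      (mem_span_image_hilbertBasis_iff b).1 hx i fun hiS => hi.not_ge (hS i hiS)⟩

theorem finrank_le_card_of_mul_norm_sq_le (ha : IsDiagonal b a μ) {r t : ℝ≥0} (hrt : r < t)
    {S : Finset ι} (hS : ∀ i, r < μ i → i ∈ S) {V : Submodule ℂ H}
    (hV : ∀ x ∈ V, t * ‖x‖ ^ 2 ≤ (inner ℂ x (a x)).re) : Module.finrank ℂ V ≤ S.card := by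
  by_contra! hlt
  obtain ⟨x, hxV, hx0, hxS⟩ := exists_mem_ne_zero_forall_inner_eq_zero b hlt
  have hpos : 0 < ‖x‖ ^ 2 := by positivity
  have hle := (hV x hxV).trans (ha.re_inner_le_mul_norm_sq fun i hi => hxS i (hS i hi))
  exact (le_of_mul_le_mul_right hle hpos).not_gt (NNReal.coe_lt_coe.2 hrt)

theorem natCast_lt_encard_iff_exists_submodule (ha : IsDiagonal b a μ) {r : ℝ≥0} {n : ℕ} :
    (n : ℕ∞) < {i | r < μ i}.encard ↔
      ∃ t > r, ∃ V : Submodule ℂ H, Module.finrank ℂ V = n + 1 ∧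
        ∀ x ∈ V, t * ‖x‖ ^ 2 ≤ (inner ℂ x (a x)).re := by
  constructor
  · intro h
    obtain ⟨S, hS, hcard⟩ := natCast_lt_encard_iff.1 h
    obtain ⟨t, hrt, ht⟩ := exists_lt_forall_le_of_forall_lt (μ := μ) hS
    exact ⟨t, hrt, hcard ▸ ha.exists_submodule_mul_norm_sq_le ht⟩
  · rintro ⟨t, hrt, V, hVn, hV⟩
    by_contra! h
    have hfin := Set.finite_of_encard_le_coe h
    rw [hfin.encard_eq_coe_toFinset_card, Nat.cast_le] at h
    have hle := ha.finrank_le_card_of_mul_norm_sq_le hrt (fun _ hi => hfin.mem_toFinset.2 hi) hV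
    lia

variable [CompleteSpace H]

theorem lt_eigenvalueSeq_iff {a : KPos H} (ha : IsDiagonal b a.1 μ) {r : ℝ≥0} {n : ℕ} :
    r < a.eigenvalueSeq n ↔ (n : ℕ∞) < {i | r < μ i}.encard := by
  have hmem : ∀ t, ((n + 1 : ℕ) : Cardinal) ≤ Module.rank ℂ (spectralSubspace a.1 t) ↔
      ∃ S : Finset ι, ↑S ⊆ {i | t ≤ μ i} ∧ S.card = n + 1 := fun t => by
    rw [ha.natCast_le_rank_spectralSubspace_iff, natCast_le_encard_iff]
  have hbdd : BddAbove {t | ((n + 1 : ℕ) : Cardinal) ≤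
      Module.rank ℂ (spectralSubspace a.1 t)} := by
    refine ⟨‖a.1‖₊, fun t ht => ?_⟩
    obtain ⟨S, hS, hcard⟩ := (hmem t).1 ht
    obtain ⟨i, hi⟩ : S.Nonempty := Finset.card_pos.1 (by lia)
    exact le_trans (hS hi) (ha.le_norm i)
  change r < sSup {t | ((n + 1 : ℕ) : Cardinal) ≤ Module.rank ℂ (spectralSubspace a.1 t)} ↔ _
  rw [lt_csSup_iff' hbdd, natCast_lt_encard_iff]
  constructor
  · rintro ⟨t, ht, hrt⟩
    obtain ⟨S, hS, hcard⟩ := (hmem t).1 ht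
    exact ⟨S, fun i hi => hrt.trans_le (hS hi), hcard⟩
  · rintro ⟨S, hS, hcard⟩
    obtain ⟨t, hrt, ht⟩ := exists_lt_forall_le_of_forall_lt (μ := μ) hS
    exact ⟨t, (hmem t).2 ⟨S, ht, hcard⟩, hrt⟩

theorem eigenvalueSeq_congr {a c : KPos H} (ha : IsDiagonal b a.1 μ)
    {b' : HilbertBasis ι ℂ H} (hc : IsDiagonal b' c.1 μ) :
    a.eigenvalueSeq = c.eigenvalueSeq :=
  funext fun _ => eq_of_forall_lt_iff fun _ => by
    rw [ha.lt_eigenvalueSeq_iff, hc.lt_eigenvalueSeq_iff]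

theorem funcCalc {a : KPos H} (ha : IsDiagonal b a.1 μ) {f : ℝ≥0 → ℝ≥0} (hf0 : f 0 = 0)
    (hf : ContinuousOn f (spectrum ℝ≥0 a.1)) : IsDiagonal b (a.funcCalc f hf0).1 (f ∘ μ) :=
  ha.cfc hf

theorem truncate {a : KPos H} (ha : IsDiagonal b a.1 μ) (k : ℝ≥0) :
    IsDiagonal b (a.truncate k).1 fun i => min k (μ i) :=
  ha.cfc (f := fun x => min k x) (by fun_prop)

end IsDiagonal

variable [CompleteSpace H]

namespace KPos

theorem lt_eigenvalueSeq_iff_exists_submodule {a : KPos H} {r : ℝ≥0} {n : ℕ} :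
    r < a.eigenvalueSeq n ↔ ∃ t > r, ∃ V : Submodule ℂ H, Module.finrank ℂ V = n + 1 ∧
      ∀ x ∈ V, t * ‖x‖ ^ 2 ≤ (inner ℂ x (a.1 x)).re := by
  obtain ⟨ι, b, μ, ha⟩ := exists_isDiagonal a.2.1 a.2.2
  rw [ha.lt_eigenvalueSeq_iff, ha.natCast_lt_encard_iff_exists_submodule]

theorem eigenvalueSeq_le_add {a c : KPos H} {d : ℝ≥0}
    (h : a.1 ≤ c.1 + algebraMap ℝ (H →L[ℂ] H) d) (n : ℕ) :
    a.eigenvalueSeq n ≤ c.eigenvalueSeq n + d := by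
  refine le_of_forall_lt fun r hr => ?_
  obtain ⟨t, hrt, V, hVn, hV⟩ := lt_eigenvalueSeq_iff_exists_submodule.1 hr
  rcases lt_or_ge r d with hrd | hdr
  · exact hrd.trans_le le_add_self
  rw [← tsub_lt_iff_right hdr]
  refine lt_eigenvalueSeq_iff_exists_submodule.2
    ⟨t - d, tsub_lt_tsub_right_of_le hdr hrt, V, hVn, fun x hx => ?_⟩
  have hform := ((ContinuousLinearMap.le_def _ _).1 h).re_inner_nonneg_right x
  have hd : inner ℂ x (algebraMap ℝ (H →L[ℂ] H) d x) = ((d * ‖x‖ ^ 2 : ℝ) : ℂ) := by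
    simp [Algebra.algebraMap_eq_smul_one, inner_smul_right_eq_smul]
  rw [sub_apply, add_apply, inner_sub_right, inner_add_right, hd] at hform
  simp only [map_sub, map_add, RCLike.re_to_complex, Complex.ofReal_re] at hform
  rw [NNReal.coe_sub (hdr.trans hrt.le), sub_mul]
  linarith [hV x hx]

theorem eigenvalueSeq_mono {a c : KPos H} (h : a ≤ c) (n : ℕ) :
    a.eigenvalueSeq n ≤ c.eigenvalueSeq n := by
  have hac : a.1 ≤ c.1 + algebraMap ℝ (H →L[ℂ] H) (0 : ℝ≥0) := by simpa using h
  simpa using eigenvalueSeq_le_add hac n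

theorem lipschitzWith_eigenvalueSeq (n : ℕ) :
    LipschitzWith 1 fun a : KPos H => a.eigenvalueSeq n := by
  refine LipschitzWith.of_le_add fun a c => ?_
  have hsa : IsSelfAdjoint (a.1 - c.1) := (IsSelfAdjoint.of_nonneg a.2.2).sub (.of_nonneg c.2.2)
  refine NNReal.coe_le_coe.2 (eigenvalueSeq_le_add (d := nndist a c) ?_ n)
  rw [← sub_le_iff_le_add', coe_nndist, Subtype.dist_eq, dist_eq_norm]
  exact hsa.le_algebraMap_norm_self

theorem eigenvalueSeq_conj (u : unitary (H →L[ℂ] H)) (a : KPos H) :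
    (conj u a).eigenvalueSeq = a.eigenvalueSeq := by
  obtain ⟨ι, b, μ, ha⟩ := exists_isDiagonal a.2.1 a.2.2
  obtain ⟨b', hb'⟩ := ha.exists_conj u
  exact IsDiagonal.eigenvalueSeq_congr (a := conj u a) hb' ha

theorem eigenvalueSeq_truncate (k : ℝ≥0) (a : KPos H) (n : ℕ) :
    (a.truncate k).eigenvalueSeq n = min k (a.eigenvalueSeq n) := by
  obtain ⟨ι, b, μ, ha⟩ := exists_isDiagonal a.2.1 a.2.2
  refine eq_of_forall_lt_iff fun r => ?_
  rw [lt_min_iff, ha.lt_eigenvalueSeq_iff, (ha.truncate k).lt_eigenvalueSeq_iff]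
  by_cases hk : r < k <;> simp [hk]

theorem eigenvalueSeq_funcCalc_max (a : KPos H) {f g : ℝ≥0 → ℝ≥0} (hf0 : f 0 = 0) (hg0 : g 0 = 0)
    (hf : ContinuousOn f (spectrum ℝ≥0 a.1)) (hg : ContinuousOn g (spectrum ℝ≥0 a.1))
    (hfg : ComonotonicOn f g (spectrum ℝ≥0 a.1)) (n : ℕ) :
    (a.funcCalc (fun x => max (f x) (g x)) (by simp [hf0, hg0])).eigenvalueSeq n =
      max ((a.funcCalc f hf0).eigenvalueSeq n) ((a.funcCalc g hg0).eigenvalueSeq n) := by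
  obtain ⟨ι, b, μ, ha⟩ := exists_isDiagonal a.2.1 a.2.2
  refine eq_of_forall_lt_iff fun r => ?_
  rw [lt_max_iff, (ha.funcCalc hf0 hf).lt_eigenvalueSeq_iff,
    (ha.funcCalc hg0 hg).lt_eigenvalueSeq_iff,
    (ha.funcCalc (f := fun x => max (f x) (g x)) _ (hf.sup hg)).lt_eigenvalueSeq_iff]
  have hvary : Monovary (f ∘ μ) (g ∘ μ) := fun i j =>
    comonotonicOn_iff_monovaryOn.1 hfg (ha.mem_spectrum i) (ha.mem_spectrum j)
  rw [← lt_max_iff, ← encard_setOf_lt_max_of_monovary hvary]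
  rfl

theorem eigenvalueSeq_eq_zero_of_finrank_range_le {a : KPos H} {n : ℕ}
    [FiniteDimensional ℂ (LinearMap.range (a.1 : H →ₗ[ℂ] H))]
    (h : Module.finrank ℂ (LinearMap.range (a.1 : H →ₗ[ℂ] H)) ≤ n) : a.eigenvalueSeq n = 0 := by
  refine le_antisymm (csSup_le' fun t ht => ?_) zero_le
  by_contra! hpos
  have hrank : ((n + 1 : ℕ) : Cardinal) ≤ Module.rank ℂ (LinearMap.range (a.1 : H →ₗ[ℂ] H)) :=
    ht.trans (Submodule.rank_mono (spectralSubspace_le_range a.1 hpos))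
  rw [← Module.finrank_eq_rank, Nat.cast_le] at hrank
  lia

end KPos

end EigenvalueSeq

section Necessity

variable {H : Type u} [NormedAddCommGroup H] [InnerProductSpace ℂ H] [CompleteSpace H]
  {α : ℕ → ℝ≥0}

theorem sugenoTrace_mono : Monotone fun a : KPos H => sugenoTrace α a := fun _ _ hac =>
  iSup_mono fun n => ENNReal.coe_le_coe.2 (min_le_min_right _ (KPos.eigenvalueSeq_mono hac n))

theorem sugenoTrace_conj (u : unitary (H →L[ℂ] H)) (a : KPos H) :
    sugenoTrace α (KPos.conj u a) = sugenoTrace α a := by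
  rw [sugenoTrace, KPos.eigenvalueSeq_conj, sugenoTrace]

theorem sugenoTrace_truncate (k : ℝ≥0) (a : KPos H) :
    sugenoTrace α (a.truncate k) = min (k : ℝ≥0∞) (sugenoTrace α a) := by
  simp only [sugenoTrace, KPos.eigenvalueSeq_truncate, min_assoc, ENNReal.coe_min]
  exact (inf_iSup_eq (α := ℝ≥0∞) _ _).symm

theorem sugenoTrace_funcCalc_max (a : KPos H) {f g : ℝ≥0 → ℝ≥0} (hf0 : f 0 = 0) (hg0 : g 0 = 0)
    (hf : ContinuousOn f (spectrum ℝ≥0 a.1)) (hg : ContinuousOn g (spectrum ℝ≥0 a.1))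
    (hfg : ComonotonicOn f g (spectrum ℝ≥0 a.1)) :
    sugenoTrace α (a.funcCalc (fun x => max (f x) (g x)) (by simp [hf0, hg0])) =
      max (sugenoTrace α (a.funcCalc f hf0)) (sugenoTrace α (a.funcCalc g hg0)) := by
  simp only [sugenoTrace, a.eigenvalueSeq_funcCalc_max hf0 hg0 hf hg hfg, min_max_distrib_right,
    ENNReal.coe_max]
  exact iSup_sup_eq (α := ℝ≥0∞)

theorem lowerSemicontinuous_sugenoTrace :
    LowerSemicontinuous fun a : KPos H => sugenoTrace α a :=
  lowerSemicontinuous_iSup fun n => Continuous.lowerSemicontinuous <|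
    ENNReal.continuous_coe.comp <|
      (KPos.lipschitzWith_eigenvalueSeq n).continuous.min continuous_const

theorem sugenoTrace_le_of_finrank_range_le (hα : Monotone α) {a : KPos H} {n : ℕ}
    [FiniteDimensional ℂ (LinearMap.range (a.1 : H →ₗ[ℂ] H))]
    (h : Module.finrank ℂ (LinearMap.range (a.1 : H →ₗ[ℂ] H)) ≤ n) : sugenoTrace α a ≤ α n := by
  refine iSup_le fun m => ENNReal.coe_le_coe.2 ?_
  rcases lt_or_ge m n with hm | hm
  · exact (min_le_right _ _).trans (hα hm)
  · simp [KPos.eigenvalueSeq_eq_zero_of_finrank_range_le (h.trans hm)]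

variable {ψ : KPos H → ℝ≥0}

theorem monotone_of_eq_sugenoTrace (hψ : ∀ a, (ψ a : ℝ≥0∞) = sugenoTrace α a) : Monotone ψ :=
  fun a c hac => by
    rw [← ENNReal.coe_le_coe, hψ, hψ]
    exact sugenoTrace_mono hac

theorem unitarilyInvariant_of_eq_sugenoTrace (hψ : ∀ a, (ψ a : ℝ≥0∞) = sugenoTrace α a) :
    UnitarilyInvariant ψ := fun a u => by
  rw [← ENNReal.coe_inj, hψ, hψ, sugenoTrace_conj]

theorem positivelyFHomogeneous_of_eq_sugenoTrace
    (hψ : ∀ a, (ψ a : ℝ≥0∞) = sugenoTrace α a) : PositivelyFHomogeneous ψ := fun a k => by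
  rw [← ENNReal.coe_inj, ENNReal.coe_min, hψ, hψ, sugenoTrace_truncate]

theorem comonotonicFAdditive_of_eq_sugenoTrace (hψ : ∀ a, (ψ a : ℝ≥0∞) = sugenoTrace α a) :
    ComonotonicFAdditive ψ := fun a f g hf0 hg0 hf hg hfg => by
  rw [← ENNReal.coe_inj, ENNReal.coe_max, hψ, hψ, hψ,
    sugenoTrace_funcCalc_max a hf0 hg0 hf hg hfg]

theorem lowerSemicontinuous_of_eq_sugenoTrace (hψ : ∀ a, (ψ a : ℝ≥0∞) = sugenoTrace α a) :
    LowerSemicontinuous ψ := fun a r hr => by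
  have hr' : (r : ℝ≥0∞) < sugenoTrace α a := hψ a ▸ ENNReal.coe_lt_coe.2 hr
  filter_upwards [lowerSemicontinuous_sugenoTrace a r hr'] with c hc
  exact ENNReal.coe_lt_coe.1 (hψ c ▸ hc)

theorem KPos.scale_mono {c d : ℝ≥0} (hcd : c ≤ d) {a b : KPos H} (hab : a ≤ b) :
    a.scale c ≤ b.scale d :=
  calc (c : ℝ) • a.1 ≤ (c : ℝ) • b.1 := smul_le_smul_of_nonneg_left hab c.2
    _ ≤ (d : ℝ) • b.1 := smul_le_smul_of_nonneg_right (NNReal.coe_le_coe.2 hcd) b.2.2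

theorem finiteLimitOnFiniteRank_of_eq_sugenoTrace (hα : Monotone α)
    (hψ : ∀ a, (ψ a : ℝ≥0∞) = sugenoTrace α a) : FiniteLimitOnFiniteRank ψ := by
  intro a _
  have hmono : Monotone fun c : ℝ≥0 => ψ (a.scale c) := fun c d hcd =>
    monotone_of_eq_sugenoTrace hψ (KPos.scale_mono hcd le_rfl)
  refine ⟨_, tendsto_atTop_ciSup hmono
    ⟨α (Module.finrank ℂ (LinearMap.range (a.1 : H →ₗ[ℂ] H))), ?_⟩⟩
  rintro _ ⟨c, rfl⟩
  have hrange : LinearMap.range ((a.scale c).1 : H →ₗ[ℂ] H) ≤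
      LinearMap.range (a.1 : H →ₗ[ℂ] H) := by
    rintro _ ⟨x, rfl⟩
    exact ⟨(c : ℝ) • x, a.1.map_smul_of_tower (c : ℝ) x⟩
  have := Submodule.finiteDimensional_of_le hrange
  rw [← ENNReal.coe_le_coe, hψ]
  exact sugenoTrace_le_of_finrank_range_le hα (Submodule.finrank_mono hrange)

theorem ComonotonicFAdditive.monotonicIncreasingFAdditive (h : ComonotonicFAdditive ψ) :
    MonotonicIncreasingFAdditive ψ := fun a f g hf0 hg0 hf hg hfm hgm =>
  h a f g hf0 hg0 hf hg (comonotonicOn_iff_monovaryOn.2 (hfm.monovaryOn hgm))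

end Necessity

section Isometry

variable {𝕜 E E' : Type*} [RCLike 𝕜] [NormedAddCommGroup E] [InnerProductSpace 𝕜 E]
  [NormedAddCommGroup E'] [InnerProductSpace 𝕜 E']

theorem nonempty_linearIsometry_of_finrank_le [FiniteDimensional 𝕜 E] [FiniteDimensional 𝕜 E']
    (h : Module.finrank 𝕜 E ≤ Module.finrank 𝕜 E') : Nonempty (E →ₗᵢ[𝕜] E') := by
  let v := stdOrthonormalBasis 𝕜 E
  let w := stdOrthonormalBasis 𝕜 E'
  let f : E →ₗ[𝕜] E' := v.toBasis.constr 𝕜 fun i => w (Fin.castLE h i)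
  have hf : f ∘ v.toBasis = fun i => w (Fin.castLE h i) :=
    funext fun i => v.toBasis.constr_basis 𝕜 _ i
  have hv : Orthonormal 𝕜 v.toBasis := by simp
  exact ⟨f.isometryOfOrthonormal hv <|
    hf ▸ w.orthonormal.comp _ (Fin.castLE_injective h)⟩

theorem exists_linearIsometryEquiv_eq_on (F : Submodule 𝕜 E) [F.HasOrthogonalProjection]
    (T : F ≃ₗᵢ[𝕜] F) : ∃ e : E ≃ₗᵢ[𝕜] E, ∀ x : F, e x = T x := by
  refine ⟨F.orthogonalDecomposition.trans
    ((LinearIsometryEquiv.withLpProdCongr 2 T (LinearIsometryEquiv.refl 𝕜 Fᗮ)).trans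
      F.orthogonalDecomposition.symm), fun x => ?_⟩
  have hF : ∀ y : F, F.orthogonalDecomposition y = WithLp.toLp 2 (y, 0) := fun y => by
    simp [Submodule.orthogonalDecomposition_apply]
  rw [LinearIsometryEquiv.trans_apply, LinearIsometryEquiv.trans_apply,
    LinearIsometryEquiv.symm_apply_eq, hF, hF]
  simp

theorem exists_linearIsometryEquiv_map_le {V W : Submodule 𝕜 E} [FiniteDimensional 𝕜 V]
    [FiniteDimensional 𝕜 W] (h : Module.finrank 𝕜 V ≤ Module.finrank 𝕜 W) :
    ∃ e : E ≃ₗᵢ[𝕜] E, V.map (e.toLinearEquiv : E →ₗ[𝕜] E) ≤ W := by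
  let F := V ⊔ W
  have hV : V ≤ F := le_sup_left
  have hW : W ≤ F := le_sup_right
  obtain ⟨L⟩ := nonempty_linearIsometry_of_finrank_le (𝕜 := 𝕜) (E := V.submoduleOf F) (E' := W)
    ((Submodule.submoduleOfEquivOfLe hV).finrank_eq.trans_le h)
  let inclW : W →ₗᵢ[𝕜] F := ⟨Submodule.inclusion hW, fun _ => rfl⟩
  obtain ⟨e, he⟩ := exists_linearIsometryEquiv_eq_on F
    ((inclW.comp L).extend.toLinearIsometryEquiv rfl)
  refine ⟨e, ?_⟩
  rintro _ ⟨x, hx, rfl⟩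
  have hex : e x = inclW (L ⟨⟨x, hV hx⟩, hx⟩) :=
    (he ⟨x, hV hx⟩).trans <|
      congrArg Subtype.val ((inclW.comp L).extend_apply ⟨⟨x, hV hx⟩, hx⟩)
  exact hex ▸ (L ⟨⟨x, hV hx⟩, hx⟩).2

end Isometry

section Projection

variable {H : Type u} [NormedAddCommGroup H] [InnerProductSpace ℂ H] [CompleteSpace H]

namespace KPos

/-- The orthogonal projection onto a finite-dimensional subspace, as an element of `K(H)⁺`; the
numbers `ψ(c P_V)` determine `ψ`. -/
noncomputable def proj (V : Submodule ℂ H) [FiniteDimensional ℂ V] : KPos H :=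
  ⟨V.starProjection,
    (isCompactOperator_of_locallyCompactSpace_dom V.orthogonalProjectionOnto).clm_comp V.subtypeL,
    isStarProjection_starProjection.nonneg⟩

theorem proj_mono {V W : Submodule ℂ H} [FiniteDimensional ℂ V] [FiniteDimensional ℂ W]
    (h : V ≤ W) : proj V ≤ proj W :=
  Submodule.starProjection_le_starProjection_iff.2 h

theorem range_proj (V : Submodule ℂ H) [FiniteDimensional ℂ V] :
    LinearMap.range ((proj V).1 : H →ₗ[ℂ] H) = V :=
  Submodule.range_starProjection V

theorem proj_map (e : H ≃ₗᵢ[ℂ] H) (V : Submodule ℂ H) [FiniteDimensional ℂ V] :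
    proj (V.map (e.toLinearEquiv : H →ₗ[ℂ] H)) =
      conj (Unitary.linearIsometryEquiv.symm e) (proj V) := by
  refine Subtype.ext (ContinuousLinearMap.ext fun x => ?_)
  have hstar : star (Unitary.linearIsometryEquiv.symm e : H →L[ℂ] H) x = e.symm x := by
    rw [ContinuousLinearMap.star_eq_adjoint, Unitary.coe_symm_linearIsometryEquiv_apply,
      LinearIsometryEquiv.adjoint_eq_symm]
    rfl
  simp only [conj, proj, mul_apply_eq_comp, hstar]
  exact Submodule.starProjection_map_apply e V x

theorem scale_conj (u : unitary (H →L[ℂ] H)) (c : ℝ≥0) (a : KPos H) :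
    (conj u a).scale c = conj u (a.scale c) :=
  Subtype.ext <| by simp [conj, scale]

theorem exists_conj_scale_proj_le {V W : Submodule ℂ H} [FiniteDimensional ℂ V]
    [FiniteDimensional ℂ W] (h : Module.finrank ℂ V ≤ Module.finrank ℂ W) (c : ℝ≥0) :
    ∃ u : unitary (H →L[ℂ] H), conj u ((proj V).scale c) ≤ (proj W).scale c := by
  obtain ⟨e, he⟩ := exists_linearIsometryEquiv_map_le h
  refine ⟨Unitary.linearIsometryEquiv.symm e, ?_⟩
  rw [← scale_conj, ← proj_map]
  exact scale_mono le_rfl (proj_mono he)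

theorem truncate_scale_of_isIdempotentElem {p : KPos H} (hp : IsIdempotentElem p.1) (k c : ℝ≥0) :
    (p.scale c).truncate k = p.scale (min k c) := by
  obtain ⟨ι, b, μ, hμ⟩ := exists_isDiagonal p.2.1 p.2.2
  have hμ01 : ∀ i, μ i = 0 ∨ μ i = 1 := fun i => by
    have h := DFunLike.congr_fun hp.eq (b i)
    rw [mul_apply_eq_comp, hμ i, map_smul, hμ i, smul_smul] at h
    have hidem : μ i * μ i = μ i := by
      exact_mod_cast smul_left_injective ℂ (b.orthonormal.ne_zero i) h
    exact IsIdempotentElem.iff_eq_zero_or_one.1 hidem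
  have hentries : (fun i => min k (c * μ i)) = fun i => min k c * μ i := funext fun i => by
    rcases hμ01 i with h | h <;> simp [h]
  refine Subtype.ext (IsDiagonal.unique
    (IsDiagonal.truncate (a := p.scale c) (hμ.smul c) k) ?_)
  exact hentries ▸ hμ.smul (min k c)

theorem truncate_scale_proj (V : Submodule ℂ H) [FiniteDimensional ℂ V] (k c : ℝ≥0) :
    ((proj V).scale c).truncate k = (proj V).scale (min k c) :=
  truncate_scale_of_isIdempotentElem isStarProjection_starProjection.isIdempotentElem k c

end KPos

namespace IsDiagonal

variable {ι : Type*} {b : HilbertBasis ι ℂ H} {a : KPos H} {μ : ι → ℝ≥0} {S : Finset ι}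

open Classical in
theorem proj_span_image (b : HilbertBasis ι ℂ H) (S : Finset ι) :
    IsDiagonal b (KPos.proj (Submodule.span ℂ (b '' S))).1 fun i => if i ∈ S then 1 else 0 := by
  intro i
  dsimp only
  split_ifs with hi
  · rw [NNReal.coe_one, Complex.ofReal_one, one_smul]
    exact Submodule.starProjection_eq_self_iff.2 (Submodule.subset_span ⟨i, hi, rfl⟩)
  · rw [NNReal.coe_zero, Complex.ofReal_zero, zero_smul]
    refine (Submodule.starProjection_apply_eq_zero_iff _).2
      ((Submodule.mem_orthogonal' _ _).2 fun x hx => ?_)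
    exact (mem_span_image_hilbertBasis_iff b).1 hx i hi

theorem scale_proj_le (ha : IsDiagonal b a.1 μ) {t : ℝ≥0} (ht : ∀ i ∈ S, t ≤ μ i) :
    (KPos.proj (Submodule.span ℂ (b '' S))).scale t ≤ a := by
  refine ((proj_span_image b S).smul t).mono ha fun i => ?_
  dsimp only
  split_ifs with hi
  · simpa using ht i hi
  · simp

theorem le_scale_proj (ha : IsDiagonal b a.1 μ) {t : ℝ≥0} (ht : ∀ i, μ i ≤ t)
    (hS : ∀ i ∉ S, μ i = 0) : a ≤ (KPos.proj (Submodule.span ℂ (b '' S))).scale t := by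
  refine ha.mono ((proj_span_image b S).smul t) fun i => ?_
  dsimp only
  split_ifs with hi
  · simpa using ht i
  · simp [hS i hi]

end IsDiagonal

end Projection

theorem exists_finrank_le_forall_finrank_le (K M : Type*) [DivisionRing K] [AddCommGroup M]
    [Module K M] (n : ℕ) : ∃ W : Submodule K M, FiniteDimensional K W ∧ Module.finrank K W ≤ n ∧
      ∀ V : Submodule K M, FiniteDimensional K V → Module.finrank K V ≤ n →
        Module.finrank K V ≤ Module.finrank K W := by
  classical
  let IsRank (m : ℕ) : Prop := ∃ V : Submodule K M, FiniteDimensional K V ∧ Module.finrank K V = m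
  have hzero : IsRank 0 := ⟨⊥, inferInstance, finrank_bot K M⟩
  obtain ⟨W, hW, hWn⟩ := Nat.findGreatest_spec (zero_le (a := n)) hzero
  exact ⟨W, hW, hWn.trans_le (Nat.findGreatest_le n), fun V hV hVn =>
    hWn ▸ Nat.le_findGreatest hVn ⟨V, hV, rfl⟩⟩

theorem exists_continuous_monotone_of_lt {r t : ℝ≥0} (hrt : r < t) (M : ℝ≥0) :
    ∃ g : ℝ≥0 → ℝ≥0, Continuous g ∧ Monotone g ∧ (∀ x ≤ r, g x = 0) ∧ ∀ x ≥ t, M ≤ g x := by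
  refine ⟨fun x => M / (t - r) * (x - r), by fun_prop, fun x y hxy => ?_, fun x hx => ?_,
    fun x hx => ?_⟩
  · dsimp only
    gcongr
  · dsimp only
    rw [tsub_eq_zero_of_le hx, mul_zero]
  · calc M = M / (t - r) * (t - r) := (div_mul_cancel₀ _ (tsub_pos_of_lt hrt).ne').symm
      _ ≤ M / (t - r) * (x - r) := by gcongr

section Sufficiency

variable {H : Type u} [NormedAddCommGroup H] [InnerProductSpace ℂ H] [CompleteSpace H]

/-- The weight `α(n) = lim ψ(c p)`, as `c → ∞`, of a projection `p` of rank `n`. Taking the supremum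
over all ranks `≤ n` makes it monotone in `n` even if `H` has finite dimension. -/
noncomputable def rankWeight (ψ : KPos H → ℝ≥0) (n : ℕ) : ℝ≥0 :=
  sSup {x | ∃ (V : Submodule ℂ H) (_ : FiniteDimensional ℂ V) (c : ℝ≥0),
    Module.finrank ℂ V ≤ n ∧ ψ ((KPos.proj V).scale c) = x}

variable {ψ : KPos H → ℝ≥0}

theorem apply_scale_proj_le_of_finrank_le (hu : UnitarilyInvariant ψ) (hmono : Monotone ψ)
    {V W : Submodule ℂ H} [FiniteDimensional ℂ V] [FiniteDimensional ℂ W]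
    (h : Module.finrank ℂ V ≤ Module.finrank ℂ W) (c : ℝ≥0) :
    ψ ((KPos.proj V).scale c) ≤ ψ ((KPos.proj W).scale c) := by
  obtain ⟨u, hle⟩ := KPos.exists_conj_scale_proj_le h c
  rw [← hu _ u]
  exact hmono hle

theorem bddAbove_apply_scale_proj (hu : UnitarilyInvariant ψ) (hmono : Monotone ψ)
    (hl : FiniteLimitOnFiniteRank ψ) (n : ℕ) :
    BddAbove {x | ∃ (V : Submodule ℂ H) (_ : FiniteDimensional ℂ V) (c : ℝ≥0),
      Module.finrank ℂ V ≤ n ∧ ψ ((KPos.proj V).scale c) = x} := by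
  obtain ⟨W, _, -, hW⟩ := exists_finrank_le_forall_finrank_le ℂ H n
  obtain ⟨L, hL⟩ := hl (KPos.proj W) (by rw [KPos.range_proj]; infer_instance)
  refine ⟨L, ?_⟩
  rintro _ ⟨V, hV, c, hVn, rfl⟩
  have hmonoc : Monotone fun c : ℝ≥0 => ψ ((KPos.proj W).scale c) := fun _ _ hcd =>
    hmono (KPos.scale_mono hcd le_rfl)
  exact (apply_scale_proj_le_of_finrank_le hu hmono (hW V hV hVn) c).trans
    (hmonoc.ge_of_tendsto hL c)

theorem rankWeight_mono (hu : UnitarilyInvariant ψ) (hmono : Monotone ψ)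
    (hl : FiniteLimitOnFiniteRank ψ) : Monotone (rankWeight ψ) := fun _ m hnm =>
  csSup_le_csSup' (bddAbove_apply_scale_proj hu hmono hl m)
    fun _ ⟨V, hV, c, hVn, hx⟩ => ⟨V, hV, c, hVn.trans hnm, hx⟩

theorem rankWeight_zero (hh : PositivelyFHomogeneous ψ) : rankWeight ψ 0 = 0 := by
  refine le_antisymm (csSup_le' ?_) zero_le
  rintro _ ⟨V, _, c, hV, rfl⟩
  obtain rfl : V = ⊥ := Submodule.finrank_eq_zero.1 (Nat.le_zero.1 hV)
  have hzero : (KPos.proj (⊥ : Submodule ℂ H)).scale c =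
      ((KPos.proj ⊥).scale c).truncate 0 := by
    rw [KPos.truncate_scale_proj]
    exact Subtype.ext (by simp [KPos.scale, KPos.proj])
  rw [hzero, hh]
  exact min_le_left _ _

theorem apply_scale_proj_le_rankWeight (hu : UnitarilyInvariant ψ) (hmono : Monotone ψ)
    (hl : FiniteLimitOnFiniteRank ψ) {V : Submodule ℂ H} [FiniteDimensional ℂ V] (k : ℝ≥0) :
    ψ ((KPos.proj V).scale k) ≤ rankWeight ψ (Module.finrank ℂ V) :=
  le_csSup (bddAbove_apply_scale_proj hu hmono hl _) ⟨V, ‹_›, k, le_rfl, rfl⟩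

theorem min_rankWeight_le_apply_scale_proj (hu : UnitarilyInvariant ψ) (hmono : Monotone ψ)
    (hh : PositivelyFHomogeneous ψ) {V : Submodule ℂ H} [FiniteDimensional ℂ V] (k : ℝ≥0) :
    min k (rankWeight ψ (Module.finrank ℂ V)) ≤ ψ ((KPos.proj V).scale k) := by
  refine le_of_forall_lt fun r hr => ?_
  obtain ⟨hrk, hrw⟩ := lt_min_iff.1 hr
  obtain ⟨_, ⟨W, _, c, hWV, rfl⟩, hrW⟩ := exists_lt_of_lt_csSup' hrw
  calc r < min k (ψ ((KPos.proj W).scale c)) := lt_min hrk hrW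
    _ = ψ ((KPos.proj W).scale (min k c)) := by rw [← hh, KPos.truncate_scale_proj]
    _ ≤ ψ ((KPos.proj W).scale k) := hmono (KPos.scale_mono (min_le_left k c) le_rfl)
    _ ≤ ψ ((KPos.proj V).scale k) := apply_scale_proj_le_of_finrank_le hu hmono hWV k

theorem sugenoTrace_rankWeight_le (hu : UnitarilyInvariant ψ) (hmono : Monotone ψ)
    (hh : PositivelyFHomogeneous ψ) (a : KPos H) : sugenoTrace (rankWeight ψ) a ≤ ψ a := by
  obtain ⟨ι, b, μ, ha⟩ := exists_isDiagonal a.2.1 a.2.2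
  refine iSup_le fun n => ENNReal.coe_le_coe.2 (le_of_forall_lt_imp_le_of_dense fun r hr => ?_)
  obtain ⟨hrn, hrw⟩ := lt_min_iff.1 hr
  obtain ⟨S, hS, hcard⟩ := natCast_lt_encard_iff.1 (ha.lt_eigenvalueSeq_iff.1 hrn)
  rw [← hcard, ← finrank_span_image_of_orthonormal b.orthonormal] at hrw
  calc r = min r (rankWeight ψ (Module.finrank ℂ (Submodule.span ℂ (b '' S)))) :=
        (min_eq_left hrw.le).symm
    _ ≤ ψ ((KPos.proj (Submodule.span ℂ (b '' S))).scale r) :=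
        min_rankWeight_le_apply_scale_proj hu hmono hh r
    _ ≤ ψ a := hmono (ha.scale_proj_le fun _ hi => (hS hi).le)

theorem le_max_apply_funcCalc (hm : MonotonicIncreasingFAdditive ψ) (hmono : Monotone ψ)
    (hh : PositivelyFHomogeneous ψ) {a : KPos H} {ι : Type*} {b : HilbertBasis ι ℂ H}
    {μ : ι → ℝ≥0} (ha : IsDiagonal b a.1 μ) {r : ℝ≥0} {g : ℝ≥0 → ℝ≥0} (hg0 : g 0 = 0)
    (hgc : Continuous g) (hgm : Monotone g) (hg : ∀ i, r < μ i → μ i ≤ g (μ i)) :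
    ψ a ≤ max r (ψ (a.funcCalc g hg0)) := by
  have hle : a ≤ a.funcCalc (fun x => max (min r x) (g x)) (by simp [hg0]) := by
    refine ha.mono (ha.funcCalc (f := fun x => max (min r x) (g x)) _ (by fun_prop)) fun i => ?_
    rcases lt_or_ge r (μ i) with hi | hi
    · exact (hg i hi).trans (le_max_right _ _)
    · exact (le_min hi le_rfl).trans (le_max_left _ _)
  calc ψ a ≤ ψ (a.funcCalc (fun x => max (min r x) (g x)) (by simp [hg0])) := hmono hle
    _ = max (ψ (a.truncate r)) (ψ (a.funcCalc g hg0)) :=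
        hm a (fun x => min r x) g (by simp) hg0 (by fun_prop) hgc.continuousOn
          (monotone_const.min monotone_id |>.monotoneOn _) (hgm.monotoneOn _)
    _ ≤ max r (ψ (a.funcCalc g hg0)) := by
        rw [hh]
        exact max_le_max_right _ (min_le_left _ _)

theorem le_max_rankWeight_card (hm : MonotonicIncreasingFAdditive ψ) (hu : UnitarilyInvariant ψ)
    (hmono : Monotone ψ) (hh : PositivelyFHomogeneous ψ) (hl : FiniteLimitOnFiniteRank ψ)
    {a : KPos H} {ι : Type*} {b : HilbertBasis ι ℂ H} {μ : ι → ℝ≥0} (ha : IsDiagonal b a.1 μ)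
    {r : ℝ≥0} {S : Finset ι} (hS : ∀ i, i ∈ S ↔ r < μ i) :
    ψ a ≤ max r (rankWeight ψ S.card) := by
  obtain ⟨t, hrt, ht⟩ := exists_lt_forall_le_of_forall_lt fun i hi => (hS i).1 hi
  obtain ⟨g, hgc, hgm, hgr, hgt⟩ := exists_continuous_monotone_of_lt hrt ‖a.1‖₊
  have hg0 : g 0 = 0 := hgr 0 zero_le
  have hga : a.funcCalc g hg0 ≤ (KPos.proj (Submodule.span ℂ (b '' S))).scale (g ‖a.1‖₊) :=
    (ha.funcCalc hg0 hgc.continuousOn).le_scale_proj (fun i => hgm (ha.le_norm i))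
      fun i hi => hgr _ (not_lt.1 fun h => hi ((hS i).2 h))
  refine (le_max_apply_funcCalc hm hmono hh ha hg0 hgc hgm fun i hi =>
    (ha.le_norm i).trans (hgt _ (ht i ((hS i).2 hi)))).trans (max_le_max_left r ?_)
  calc ψ (a.funcCalc g hg0)
      ≤ ψ ((KPos.proj (Submodule.span ℂ (b '' S))).scale (g ‖a.1‖₊)) := hmono hga
    _ ≤ rankWeight ψ (Module.finrank ℂ (Submodule.span ℂ (b '' S))) :=
        apply_scale_proj_le_rankWeight hu hmono hl _
    _ = rankWeight ψ S.card := by rw [finrank_span_image_of_orthonormal b.orthonormal]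

theorem le_sugenoTrace_rankWeight (hm : MonotonicIncreasingFAdditive ψ)
    (hu : UnitarilyInvariant ψ) (hmono : Monotone ψ) (hh : PositivelyFHomogeneous ψ)
    (hl : FiniteLimitOnFiniteRank ψ) (a : KPos H) : ψ a ≤ sugenoTrace (rankWeight ψ) a := by
  obtain ⟨ι, b, μ, ha⟩ := exists_isDiagonal a.2.1 a.2.2
  refine ENNReal.le_of_forall_nnreal_lt fun r hr => ?_
  rcases eq_zero_or_pos r with rfl | hr0
  · simp
  have hfin := ha.finite_setOf_lt a.2.1 hr0
  have hmax : r < max r (rankWeight ψ hfin.toFinset.card) :=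
    (ENNReal.coe_lt_coe.1 hr).trans_le
      (le_max_rankWeight_card hm hu hmono hh hl ha fun i => hfin.mem_toFinset)
  have hrw : r < rankWeight ψ hfin.toFinset.card := (lt_max_iff.1 hmax).resolve_left (lt_irrefl r)
  obtain ⟨n, hn⟩ : ∃ n, hfin.toFinset.card = n + 1 := Nat.exists_eq_succ_of_ne_zero fun h => by
    rw [h, rankWeight_zero hh] at hrw
    exact not_lt_zero hrw
  have hrn : r < a.eigenvalueSeq n := by
    rw [ha.lt_eigenvalueSeq_iff, hfin.encard_eq_coe_toFinset_card, hn, Nat.cast_lt]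
    exact n.lt_succ_self
  exact le_iSup_of_le n (ENNReal.coe_le_coe.2 (le_min hrn.le (hn ▸ hrw.le)))

theorem eq_sugenoTrace_rankWeight (hm : MonotonicIncreasingFAdditive ψ)
    (hu : UnitarilyInvariant ψ) (hmono : Monotone ψ) (hh : PositivelyFHomogeneous ψ)
    (hl : FiniteLimitOnFiniteRank ψ) (a : KPos H) : ψ a = sugenoTrace (rankWeight ψ) a :=
  le_antisymm (le_sugenoTrace_rankWeight hm hu hmono hh hl a)
    (sugenoTrace_rankWeight_le hu hmono hh a)

end Sufficiency

end SugenoTrace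

open SugenoTrace in
theorem mainTheorem2_general {H : Type*} [NormedAddCommGroup H] [InnerProductSpace ℂ H]
    [CompleteSpace H] (ψ : KPos H → ℝ≥0) :
    List.TFAE [
      ∃ α : ℕ → ℝ≥0, Monotone α ∧ α 0 = 0 ∧
        ∀ a, (ψ a : ℝ≥0∞) = sugenoTrace α a,
      MonotonicIncreasingFAdditive ψ ∧ UnitarilyInvariant ψ ∧
        Monotone ψ ∧ PositivelyFHomogeneous ψ ∧ LowerSemicontinuous ψ ∧
        FiniteLimitOnFiniteRank ψ,
      ComonotonicFAdditive ψ ∧ UnitarilyInvariant ψ ∧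
        Monotone ψ ∧ PositivelyFHomogeneous ψ ∧ LowerSemicontinuous ψ ∧
        FiniteLimitOnFiniteRank ψ] := by
  tfae_have 1 → 3 := fun ⟨_, hα, _, hψ⟩ =>
    ⟨comonotonicFAdditive_of_eq_sugenoTrace hψ, unitarilyInvariant_of_eq_sugenoTrace hψ,
      monotone_of_eq_sugenoTrace hψ, positivelyFHomogeneous_of_eq_sugenoTrace hψ,
      lowerSemicontinuous_of_eq_sugenoTrace hψ, finiteLimitOnFiniteRank_of_eq_sugenoTrace hα hψ⟩
  tfae_have 3 → 2 := fun h => ⟨h.1.monotonicIncreasingFAdditive, h.2⟩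
  tfae_have 2 → 1 := fun ⟨hm, hu, hmono, hh, _, hl⟩ =>
    ⟨rankWeight ψ, rankWeight_mono hu hmono hl, rankWeight_zero hh,
      eq_sugenoTrace_rankWeight hm hu hmono hh hl⟩
  tfae_finish

theorem mainTheorem2 {H : Type*} [NormedAddCommGroup H] [InnerProductSpace ℂ H] [CompleteSpace H]
    [TopologicalSpace.SeparableSpace H] (hH : ¬ FiniteDimensional ℂ H)
    (ψ : SugenoTrace.KPos H → ℝ≥0) :
    List.TFAE [
      ∃ α : ℕ → ℝ≥0, Monotone α ∧ α 0 = 0 ∧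
        ∀ a, (ψ a : ℝ≥0∞) = SugenoTrace.sugenoTrace α a,
      SugenoTrace.MonotonicIncreasingFAdditive ψ ∧ SugenoTrace.UnitarilyInvariant ψ ∧
        Monotone ψ ∧ SugenoTrace.PositivelyFHomogeneous ψ ∧ LowerSemicontinuous ψ ∧
        SugenoTrace.FiniteLimitOnFiniteRank ψ,
      SugenoTrace.ComonotonicFAdditive ψ ∧ SugenoTrace.UnitarilyInvariant ψ ∧
        Monotone ψ ∧ SugenoTrace.PositivelyFHomogeneous ψ ∧ LowerSemicontinuous ψ ∧
        SugenoTrace.FiniteLimitOnFiniteRank ψ] :=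
  mainTheorem2_general ψ
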